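/- For positive integers $n,d$ with $n$ even, let $T_{n,d}$ be the graph with vertex set $\{0,1,\dots,n-1\}$ in which $i$ and $j$ are adjacent if and only if $\min\{|i-j|,\,n-|i-j|\}\in\{1,3,\dots,2d+1\}$. Let $\mathrm{Hom}(T_{n,d},0)$ be the (finite, non-empty) set of functions $f\colon\{0,\dots,n-1\}\to\mathbb{Z}$ with $f(0)=0$ and $|f(i)-f(j)|=1$ whenever $i$ and $j$ are adjacent, let $f_{n,d}$ be a uniformly chosen element of $\mathrm{Hom}(T_{n,d},0)$, and let $\mathrm{Rng}(f)$ denote the set of values taken by $f$. Theorem. For any positive even integer $n$ and any positive integers $d$ and $r$, \[ \Pr\big(|\mathrm{Rng}(f_{n,d})|\ge 3+r\big)\le\binom{n}{r}^2 2^{-(2d-1)r}\quad\text{and}\quad \Pr\big(|\mathrm{Rng}(f_{n,d})|<3\big)\le 2^{1-n/2}. \] Consequently, if $d=d(n)$ is such that $d(n)-\log_2 n\to\infty$ as $n\to\infty$ through even integers, then \[ \Pr\big(|\mathrm{Rng}(f_{n,d(n)})|=3\big)\to 1\quad\text{as } n\to\infty \text{ through even integers}. \] -/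

import Mathlib

open Filter Topology

/-- The set `Hom(G, v₀)` of homomorphisms from a graph `G` to `ℤ` (integer-valued functions that
change by exactly one along every edge) that map `v₀` to `0`. -/
def ZHom {V : Type*} (G : SimpleGraph V) (v₀ : V) : Set (V → ℤ) :=
  {f | f v₀ = 0 ∧ ∀ x y : V, G.Adj x y → |f x - f y| = 1}

/-- The graph `T_{n,d}` on `{0, …, n-1}`: `i` and `j` are adjacent if and only if
`min {|i - j|, n - |i - j|} ∈ {1, 3, …, 2d+1}`. -/
def torusGraph (n d : ℕ) : SimpleGraph (Fin n) where
  Adj i j := ∃ k : ℕ, k ≤ d ∧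
    min |(i : ℤ) - (j : ℤ)| ((n : ℤ) - |(i : ℤ) - (j : ℤ)|) = 2 * (k : ℤ) + 1
  symm := ⟨fun i j h => by simpa only [abs_sub_comm] using h⟩
  loopless := ⟨fun i h => by
    obtain ⟨k, -, hk⟩ := h
    simp at hk
    omega⟩

/-- The set `Hom(T_{n,d}, 0)`. (For `n = 0` there is no vertex `0` and the set is empty.) -/
def torusHom (n d : ℕ) : Set (Fin n → ℤ) :=
  {f | ∃ hn : 0 < n, f ∈ ZHom (torusGraph n d) ⟨0, hn⟩}

/-- The law of a uniformly chosen element of `Hom(T_{n,d}, 0)`. -/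
noncomputable def torusLaw (n d : ℕ) : MeasureTheory.Measure (Fin n → ℤ) :=
  ProbabilityTheory.uniformOn (torusHom n d)

theorem torusHom_finite (n d : ℕ) : (torusHom n d).Finite := by
  refine (Set.Finite.pi (t := fun _ : Fin n => Set.Icc (-(n : ℤ)) n)
    (fun _ => Set.finite_Icc _ _)).subset ?_
  rintro f ⟨hn, h0, hf⟩
  have key : ∀ m : ℕ, ∀ hm : m < n, |f ⟨m, hm⟩| ≤ m := by
    intro m
    induction m with
    | zero => intro hm; simp [h0]
    | succ m ih =>
      intro hm
      have h1 := ih (by omega)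
      have h2 := hf ⟨m + 1, hm⟩ ⟨m, by omega⟩ ⟨0, Nat.zero_le _, by
        have : |((m + 1 : ℕ) : ℤ) - (m : ℤ)| = 1 := by push_cast; simp
        simp only [this]
        omega⟩
      have h3 := abs_sub_abs_le_abs_sub (f ⟨m + 1, hm⟩) (f ⟨m, by omega⟩)
      push_cast
      linarith
  intro i _
  have : -((i : ℕ) : ℤ) ≤ f i ∧ f i ≤ ((i : ℕ) : ℤ) := abs_le.1 (key i i.2)
  have := i.2
  simp only [Set.mem_Icc]
  constructor <;> omega

theorem torusHom_nonempty {n : ℕ} (hn : 0 < n) (he : Even n) (d : ℕ) :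
    (torusHom n d).Nonempty := by
  refine ⟨fun i => ((i : ℕ) : ℤ) % 2, hn, by simp, ?_⟩
  rintro x y ⟨k, -, hk⟩
  obtain ⟨m, hm⟩ := he
  have hx := x.2
  have hy := y.2
  simp only
  rcases abs_cases ((x : ℤ) - (y : ℤ)) with ⟨h, h'⟩ | ⟨h, h'⟩ <;> rw [h] at hk <;>
    rcases min_choice ((x : ℤ) - (y : ℤ)) ((n : ℤ) - ((x : ℤ) - (y : ℤ))) with h1 | h1 <;>
    rcases Int.emod_two_eq_zero_or_one (x : ℤ) with h2 | h2 <;>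
    rcases Int.emod_two_eq_zero_or_one (y : ℤ) with h3 | h3 <;>
    rw [h2, h3] <;> first | rfl | (exfalso; omega)

theorem torusLaw_isProbabilityMeasure {n : ℕ} (hn : 0 < n) (he : Even n) (d : ℕ) :
    MeasureTheory.IsProbabilityMeasure (torusLaw n d) :=
  ProbabilityTheory.isProbabilityMeasure_uniformOn (torusHom_finite n d)
    (torusHom_nonempty hn he d)

/-! Call `s` a turn of `f` on `ZMod n` if `f s ≠ f (s - 2)`. Between turns `f` alternates between
two values, so its turn set `D` and `f 1` determine it. The phase `f (s - 1)` at the last turn `s`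
stays within 1 of `f`; it changes, by 1, only at a turn at odd distance from the preceding turn. Let
`U` be the set of these turns. If `f` takes `3 + r` values, the phase moves by at least `r` along
each of the two arcs between a minimum and a maximum, so `|U| ≥ 2r`. Across an odd gap `f` rises or
falls by 3, which edges of length up to `2d + 1` forbid unless the gap is long (`two_mul_le_age`).
All turns have even age, and `U` fixes which points have even age. The `d` points `u - 1, u - 3, …`
before each `u ∈ U` have even age but are not turns, so `D \ U` lies in a set of size `(n -
(2d+1)|U|) / 2` depending only on `U`. With `|U| = 2k` this leaves at most `2 * 2 ^ (n/2 - (2d+1)k)`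
functions, while there are at least `2 ^ (n/2)` homomorphisms. The union bound gives `∑_{k ≥ r}
C(n,2k) * 2 ^ (1 - (2d+1)k)`, which `sum_choose_mul_le` compares with its leading term. -/

set_option linter.unusedSectionVars false

/-! ### Subsets of the cycle: parity of the distance back to the set. -/

section Age

variable {n : ℕ} [NeZero n]

/-- The number of steps one has to go back from `t` to reach the set `D`. -/
noncomputable def age (D : Finset (ZMod n)) (t : ZMod n) : ℕ := sInf {k : ℕ | t - (k : ZMod n) ∈ D}

/-- The points at which the age is even. -/
noncomputable def evenAge (D : Finset (ZMod n)) : Finset (ZMod n) :=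
  Finset.univ.filter fun t => Even (age D t)

/-- The elements of `D` at odd distance from the preceding element of `D`. -/
noncomputable def oddGapEnds (D : Finset (ZMod n)) : Finset (ZMod n) :=
  D.filter fun t => Even (age D (t - 1))

/-- For every `u ∈ U`, the points `u - 1, u - 3, …, u - (2d - 1)`. -/
def precedingOdd (U : Finset (ZMod n)) (d : ℕ) : Finset (ZMod n) :=
  (U ×ˢ Finset.range d).image fun p => p.1 - 1 - ((2 * p.2 : ℕ) : ZMod n)

variable {D : Finset (ZMod n)}

/-- For empty `D` the infimum defaults to 0, so the age is meaningful only for nonempty `D`. -/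
theorem sub_age_mem (hD : D.Nonempty) (t : ZMod n) : t - (age D t : ZMod n) ∈ D := by
  obtain ⟨s, hs⟩ := hD
  have : {k : ℕ | t - (k : ZMod n) ∈ D}.Nonempty := ⟨(t - s).val, by simpa using hs⟩
  exact Nat.sInf_mem this

theorem age_le {t : ZMod n} {k : ℕ} (h : t - (k : ZMod n) ∈ D) : age D t ≤ k :=
  Nat.sInf_le h

theorem age_eq_zero {t : ZMod n} (h : t ∈ D) : age D t = 0 := by
  have : age D t ≤ 0 := age_le (by simpa using h)
  omega

theorem age_eq_succ (hD : D.Nonempty) {t : ZMod n} (h : t ∉ D) :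
    age D t = age D (t - 1) + 1 := by
  apply le_antisymm
  · apply age_le
    have := sub_age_mem hD (t - 1)
    push_cast
    rwa [add_comm, ← sub_sub]
  · have h1 := sub_age_mem hD t
    obtain ⟨b, hb⟩ : ∃ b, age D t = b + 1 := by
      refine Nat.exists_eq_succ_of_ne_zero fun h0 => h ?_
      simpa [h0] using h1
    rw [hb] at h1 ⊢
    have : age D (t - 1) ≤ b := age_le (by push_cast at h1; rwa [sub_sub, add_comm])
    omega

theorem age_sub (hD : D.Nonempty) (t : ZMod n) (j : ℕ) (hj : j ≤ age D t) :
    age D (t - (j : ZMod n)) = age D t - j := by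
  induction j with
  | zero => simp
  | succ j ih =>
    have h1 := ih (by omega)
    have h2 : t - (j : ZMod n) ∉ D := fun h => by
      have := age_eq_zero h
      omega
    have h3 := age_eq_succ hD h2
    have h4 : t - ((j + 1 : ℕ) : ZMod n) = t - (j : ZMod n) - 1 := by push_cast; ring
    rw [h4]
    omega

theorem mem_evenAge {t : ZMod n} : t ∈ evenAge D ↔ Even (age D t) := by simp [evenAge]

theorem mem_oddGapEnds {t : ZMod n} : t ∈ oddGapEnds D ↔ t ∈ D ∧ Even (age D (t - 1)) := by
  simp [oddGapEnds]

theorem oddGapEnds_subset : oddGapEnds D ⊆ D := Finset.filter_subset _ _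

theorem subset_evenAge : D ⊆ evenAge D := fun t ht => by simp [mem_evenAge, age_eq_zero ht]

/-- Going forward, parity flips at every step except at the end of an odd gap, where it is even
twice in a row. This recurrence involves `D` only through `oddGapEnds D`. -/
theorem mem_evenAge_iff (hD : D.Nonempty) (t : ZMod n) :
    t ∈ evenAge D ↔ (t - 1 ∉ evenAge D ∨ t ∈ oddGapEnds D) := by
  by_cases h : t ∈ D
  · simp only [mem_evenAge, mem_oddGapEnds, age_eq_zero h, h, true_and]
    simpa using (Nat.even_or_odd _).symm
  · simp only [mem_evenAge, mem_oddGapEnds, age_eq_succ hD h, h, false_and, or_false]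
    simp [Nat.even_add_one]

/-- Sum the recurrence around the cycle. For even `n` it also shows that `oddGapEnds D` has even
size. -/
theorem two_mul_card_evenAge (hD : D.Nonempty) :
    2 * (evenAge D).card = n + (oddGapEnds D).card := by
  have h1 : ∑ t : ZMod n, ((if t ∈ evenAge D then 1 else 0) +
      (if t - 1 ∈ evenAge D then 1 else 0)) =
      ∑ t : ZMod n, (1 + (if t ∈ oddGapEnds D then 1 else 0)) := by
    refine Finset.sum_congr rfl fun t _ => ?_
    have h := mem_evenAge_iff hD t
    by_cases hu : t ∈ oddGapEnds D
    · have : t - 1 ∈ evenAge D := mem_evenAge.2 (mem_oddGapEnds.1 hu).2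
      simp [h, hu, this]
    · by_cases h' : t - 1 ∈ evenAge D <;> simp [h, hu, h']
  rw [Finset.sum_add_distrib, Finset.sum_add_distrib] at h1
  have h2 : ∑ t : ZMod n, (if t - 1 ∈ evenAge D then 1 else 0) =
      ∑ t : ZMod n, (if t ∈ evenAge D then 1 else 0) :=
    (Equiv.subRight (1 : ZMod n)).sum_comp fun t => if t ∈ evenAge D then 1 else 0
  rw [h2] at h1
  simp [ZMod.card] at h1
  omega

theorem evenAge_eq_of_oddGapEnds_eq {D' : Finset (ZMod n)} (hU : (oddGapEnds D).Nonempty)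
    (h : oddGapEnds D = oddGapEnds D') : evenAge D = evenAge D' := by
  obtain ⟨u, hu⟩ := hU
  have hu' : u ∈ oddGapEnds D' := h ▸ hu
  have hD : D.Nonempty := ⟨u, oddGapEnds_subset hu⟩
  have hD' : D'.Nonempty := ⟨u, oddGapEnds_subset hu'⟩
  have key : ∀ k : ℕ, u + (k : ZMod n) ∈ evenAge D ↔ u + (k : ZMod n) ∈ evenAge D' := by
    intro k
    induction k with
    | zero =>
      simp [subset_evenAge (oddGapEnds_subset hu), subset_evenAge (oddGapEnds_subset hu')]
    | succ k ih =>
      rw [mem_evenAge_iff hD, mem_evenAge_iff hD', h]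
      have : u + ((k + 1 : ℕ) : ZMod n) - 1 = u + (k : ZMod n) := by push_cast; ring
      rw [this, ih]
  ext t
  simpa using key (t - u).val

variable {d : ℕ}

theorem precedingOdd_spec (hD : D.Nonempty) (hgap : ∀ t ∈ oddGapEnds D, 2 * d ≤ age D (t - 1))
    {t : ZMod n} (ht : t ∈ precedingOdd (oddGapEnds D) d) : t ∈ evenAge D ∧ t ∉ D := by
  simp only [precedingOdd, Finset.mem_image, Finset.mem_product, Finset.mem_range,
    Prod.exists] at ht
  obtain ⟨u, j, ⟨hu, hj⟩, rfl⟩ := ht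
  have h1 := hgap u hu
  have h2 := age_sub hD (u - 1) (2 * j) (by omega)
  constructor
  · rw [mem_evenAge, h2, Nat.even_sub (by omega)]
    simp [(mem_oddGapEnds.1 hu).2]
  · intro h
    have := age_eq_zero h
    omega

theorem card_precedingOdd (hD : D.Nonempty) (hgap : ∀ t ∈ oddGapEnds D, 2 * d ≤ age D (t - 1)) :
    (precedingOdd (oddGapEnds D) d).card = (oddGapEnds D).card * d := by
  have key : ∀ u ∈ oddGapEnds D, ∀ u' ∈ oddGapEnds D, ∀ j < d, ∀ j' < d, j < j' →
      u - 1 - ((2 * j : ℕ) : ZMod n) ≠ u' - 1 - ((2 * j' : ℕ) : ZMod n) := by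
    intro u hu u' hu' j hj j' hj' hlt heq
    obtain ⟨i, rfl⟩ := Nat.exists_eq_add_of_lt hlt
    -- A coincidence would place `u ∈ D` strictly inside the gap that ends at `u'`.
    have h1 := hgap u' hu'
    have h2 := age_sub hD (u' - 1) (2 * i + 1) (by omega)
    have h3 : u' - 1 - ((2 * i + 1 : ℕ) : ZMod n) = u := by
      push_cast at heq ⊢
      linear_combination -heq
    rw [h3, age_eq_zero (oddGapEnds_subset hu)] at h2
    omega
  rw [precedingOdd, Finset.card_image_of_injOn, Finset.card_product, Finset.card_range]
  rintro ⟨u, j⟩ hp ⟨u', j'⟩ hp' heq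
  simp only [Finset.coe_product, Set.mem_prod, Finset.mem_coe, Finset.mem_range] at hp hp'
  simp only at heq
  rcases lt_trichotomy j j' with hlt | rfl | hlt
  · exact (key u hp.1 u' hp'.1 j hp.2 j' hp'.2 hlt heq).elim
  · simpa using heq
  · exact (key u' hp'.1 u hp.1 j' hp'.2 j hp.2 hlt heq.symm).elim

/-- The points that may be added to `oddGapEnds D` without changing the parities of the ages. -/
noncomputable def freePoints (D : Finset (ZMod n)) (d : ℕ) : Finset (ZMod n) :=
  evenAge D \ (oddGapEnds D ∪ precedingOdd (oddGapEnds D) d)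

theorem sdiff_subset_freePoints (hD : D.Nonempty)
    (hgap : ∀ t ∈ oddGapEnds D, 2 * d ≤ age D (t - 1)) :
    D \ oddGapEnds D ⊆ freePoints D d := by
  intro t ht
  rw [Finset.mem_sdiff] at ht
  simp only [freePoints, Finset.mem_sdiff, Finset.mem_union, not_or]
  exact ⟨subset_evenAge ht.1, ht.2, fun h => (precedingOdd_spec hD hgap h).2 ht.1⟩

theorem two_mul_card_freePoints (hD : D.Nonempty)
    (hgap : ∀ t ∈ oddGapEnds D, 2 * d ≤ age D (t - 1)) :
    2 * (freePoints D d).card + (2 * d + 1) * (oddGapEnds D).card = n := by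
  have hsub : oddGapEnds D ∪ precedingOdd (oddGapEnds D) d ⊆ evenAge D :=
    Finset.union_subset (oddGapEnds_subset.trans subset_evenAge)
      fun t ht => (precedingOdd_spec hD hgap ht).1
  have hdisj : Disjoint (oddGapEnds D) (precedingOdd (oddGapEnds D) d) :=
    Finset.disjoint_left.2 fun t ht ht' =>
      (precedingOdd_spec hD hgap ht').2 (oddGapEnds_subset ht)
  have h1 := Finset.card_sdiff_add_card_eq_card hsub
  rw [Finset.card_union_of_disjoint hdisj, card_precedingOdd hD hgap] at h1
  have h2 := two_mul_card_evenAge hD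
  rw [freePoints]
  nlinarith

end Age

/-! ### Turns and phase of a homomorphism on the cycle. -/

section Phase

variable {n : ℕ} [NeZero n]

/-- The points `s` with `f s ≠ f (s - 2)`. -/
def turnSet (f : ZMod n → ℤ) : Finset (ZMod n) := Finset.univ.filter fun s => f s ≠ f (s - 2)

/-- The value of `f` just before the last turn. -/
noncomputable def phase (f : ZMod n → ℤ) (t : ZMod n) : ℤ := f (t - (age (turnSet f) t : ZMod n) - 1)

/-- Integer-valued functions on the cycle that change by one along every jump `2k + 1`, `k ≤ d`. -/
def IsCycleHom (d : ℕ) (f : ZMod n → ℤ) : Prop :=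
  ∀ (k : ℕ), k ≤ d → ∀ y : ZMod n, |f (y + ((2 * k + 1 : ℕ) : ZMod n)) - f y| = 1

variable {d : ℕ} {f : ZMod n → ℤ}

theorem mem_turnSet {s : ZMod n} : s ∈ turnSet f ↔ f s ≠ f (s - 2) := by simp [turnSet]

theorem IsCycleHom.step (hf : IsCycleHom d f) (t : ZMod n) :
    f t = f (t - 1) + 1 ∨ f t = f (t - 1) - 1 := by
  have := hf 0 (Nat.zero_le _) (t - 1)
  simp only [mul_zero, zero_add, Nat.cast_one, sub_add_cancel] at this
  rcases (abs_eq one_pos.le).1 this with h | h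
  · left; omega
  · right; omega

/-- At a turn, `f` takes three consecutive integers in order, with the phase in the middle and `ε`
the direction; afterwards it alternates between the last two. -/
theorem IsCycleHom.phase_spec (hf : IsCycleHom d f) (hD : (turnSet f).Nonempty) (t : ZMod n) :
    ∃ ε : ℤ, (ε = 1 ∨ ε = -1) ∧
      f (t - (age (turnSet f) t : ZMod n) - 2) = phase f t - ε ∧
      (Even (age (turnSet f) t) → f t = phase f t + ε ∧ f (t - 1) = phase f t) ∧
      (¬ Even (age (turnSet f) t) → f t = phase f t ∧ f (t - 1) = phase f t + ε) := by
  obtain ⟨k, hk⟩ : ∃ k, age (turnSet f) t = k := ⟨_, rfl⟩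
  induction k generalizing t with
  | zero =>
    have ht : t ∈ turnSet f := by simpa [hk] using sub_age_mem hD t
    rw [mem_turnSet] at ht
    have h1 := hf.step t
    have h2 := hf.step (t - 1)
    have h3 : t - 1 - 1 = t - 2 := by ring
    rw [h3] at h2
    refine ⟨f t - f (t - 1), by omega, ?_⟩
    simp only [phase, hk, Nat.cast_zero, sub_zero]
    refine ⟨by omega, fun _ => ⟨by omega, trivial⟩, fun h => (h Even.zero).elim⟩
  | succ k ih =>
    have ht : t ∉ turnSet f := fun h => by simp [age_eq_zero h] at hk
    have hk' : age (turnSet f) (t - 1) = k := by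
      have := age_eq_succ hD ht
      omega
    obtain ⟨ε, hε, h1, h2, h3⟩ := ih (t - 1) hk'
    have hP : phase f (t - 1) = phase f t := by
      simp only [phase, hk, hk']
      congr 1
      push_cast
      ring
    have e1 : t - 1 - (k : ZMod n) - 2 = t - ((k + 1 : ℕ) : ZMod n) - 2 := by push_cast; ring
    have e2 : t - 1 - 1 = t - 2 := by ring
    rw [mem_turnSet, not_not] at ht
    rw [hk', hP, e1] at h1
    rw [hk', hP, e2, ← ht] at h2 h3
    refine ⟨ε, hε, by rw [hk, h1], ?_, ?_⟩
    · rw [hk, Nat.even_add_one]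
      exact fun h => ⟨(h3 h).2, (h3 h).1⟩
    · rw [hk, Nat.even_add_one, not_not]
      exact fun h => ⟨(h2 h).2, (h2 h).1⟩

/-- From two places before the previous turn up to `t`, `f` goes from `phase - ε` to `phase + 2ε`.
The distance is odd, so if it were at most `2d + 1` its ends would be adjacent. -/
theorem IsCycleHom.two_mul_le_age (hf : IsCycleHom d f) (t : ZMod n)
    (ht : t ∈ oddGapEnds (turnSet f)) : 2 * d ≤ age (turnSet f) (t - 1) := by
  obtain ⟨htD, hev⟩ := mem_oddGapEnds.1 ht
  obtain ⟨ε, hε, h1, h2, -⟩ := hf.phase_spec ⟨t, htD⟩ (t - 1)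
  obtain ⟨h3, h4⟩ := h2 hev
  have h5 := hf.step t
  rw [mem_turnSet] at htD
  have e2 : t - 1 - 1 = t - 2 := by ring
  rw [e2] at h4
  by_contra! hlt
  obtain ⟨c, hc⟩ := hev
  have h6 := hf (c + 1) (by omega) (t - 1 - (age (turnSet f) (t - 1) : ZMod n) - 2)
  have e3 : t - 1 - (age (turnSet f) (t - 1) : ZMod n) - 2 + ((2 * (c + 1) + 1 : ℕ) : ZMod n) = t := by
    rw [hc]
    push_cast
    ring
  rw [e3, h1] at h6
  rcases (abs_eq one_pos.le).1 h6 with h | h <;> omega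

theorem IsCycleHom.abs_phase_sub_le (hf : IsCycleHom d f) (hD : (turnSet f).Nonempty)
    (t : ZMod n) :
    |phase f t - phase f (t - 1)| ≤ if t ∈ oddGapEnds (turnSet f) then 1 else 0 := by
  by_cases htD : t ∈ turnSet f
  · have hP : phase f t = f (t - 1) := by simp [phase, age_eq_zero htD]
    obtain ⟨ε, hε, -, h2, h3⟩ := hf.phase_spec hD (t - 1)
    by_cases hev : Even (age (turnSet f) (t - 1))
    · rw [if_pos (mem_oddGapEnds.2 ⟨htD, hev⟩), hP, (h2 hev).1]
      rcases hε with rfl | rfl <;> simp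
    · rw [if_neg fun h => hev (mem_oddGapEnds.1 h).2, hP, (h3 hev).1]
      simp
  · have hP : phase f t = phase f (t - 1) := by
      simp only [phase, age_eq_succ hD htD]
      congr 1
      push_cast
      ring
    rw [if_neg fun h => htD (oddGapEnds_subset h), hP]
    simp

theorem IsCycleHom.abs_phase_add_sub_le (hf : IsCycleHom d f) (hD : (turnSet f).Nonempty)
    (x : ZMod n) (k : ℕ) :
    |phase f (x + k) - phase f x| ≤
      ∑ j ∈ Finset.range k, if x + j + 1 ∈ oddGapEnds (turnSet f) then (1 : ℤ) else 0 := by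
  induction k with
  | zero => simp
  | succ k ih =>
    rw [Finset.sum_range_succ]
    have h := hf.abs_phase_sub_le hD (x + k + 1)
    rw [add_sub_cancel_right] at h
    have e : x + ((k + 1 : ℕ) : ZMod n) = x + k + 1 := by push_cast; ring
    rw [e]
    calc _ ≤ _ := abs_sub_le _ (phase f (x + k)) _
      _ ≤ _ := by linarith

theorem sum_range_zmod (x : ZMod n) (g : ZMod n → ℤ) :
    ∑ j ∈ Finset.range n, g (x + j + 1) = ∑ t, g t := by
  refine Finset.sum_bij' (fun j _ => x + j + 1) (fun t _ => (t - x - 1).val) ?_ ?_ ?_ ?_ ?_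
  · simp
  · intro t _
    simpa using ZMod.val_lt _
  · intro j hj
    have : x + (j : ZMod n) + 1 - x - 1 = (j : ZMod n) := by ring
    rw [this]
    exact ZMod.val_cast_of_lt (Finset.mem_range.1 hj)
  · intro t _
    simp only [ZMod.natCast_val, ZMod.cast_id', id_eq]
    ring
  · simp

/-- A function that takes many values has many odd gaps between its turns. -/
theorem IsCycleHom.two_mul_le_card_oddGapEnds (hf : IsCycleHom d f) (hD : (turnSet f).Nonempty)
    {r : ℕ} (hr : 3 + r ≤ (Set.range f).ncard) : 2 * r ≤ (oddGapEnds (turnSet f)).card := by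
  obtain ⟨x, hx⟩ := Finite.exists_min f
  obtain ⟨y, hy⟩ := Finite.exists_max f
  have hrange : (2 + r : ℤ) ≤ f y - f x := by
    have h1 : (Set.range f).ncard ≤ (Set.Icc (f x) (f y)).ncard :=
      Set.ncard_le_ncard (by rintro _ ⟨t, rfl⟩; exact ⟨hx t, hy t⟩) (Set.finite_Icc _ _)
    rw [← Finset.coe_Icc, Set.ncard_coe_finset, Int.card_Icc] at h1
    omega
  have hb : ∀ t, f x + 1 ≤ phase f t ∧ phase f t ≤ f y - 1 ∧
      phase f t - 1 ≤ f t ∧ f t ≤ phase f t + 1 := by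
    intro t
    obtain ⟨ε, hε, h1, h2, h3⟩ := hf.phase_spec hD t
    have a1 := hx (t - (age (turnSet f) t : ZMod n) - 2)
    have a2 := hy (t - (age (turnSet f) t : ZMod n) - 2)
    have a3 := hx t
    have a4 := hy t
    have a5 := hx (t - 1)
    have a6 := hy (t - 1)
    by_cases hev : Even (age (turnSet f) t)
    · have := h2 hev
      omega
    · have := h3 hev
      omega
  have h1 := hb x
  have h2 := hb y
  obtain ⟨k, hk, hky⟩ : ∃ k : ℕ, k ≤ n ∧ x + k = y := ⟨(y - x).val, (ZMod.val_lt _).le, by simp⟩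
  have hx' : y + ((n - k : ℕ) : ZMod n) = x := by
    rw [Nat.cast_sub hk, ← hky]
    simp
  have h3 := hf.abs_phase_add_sub_le hD x k
  -- The complementary arc, from `y` back round to `x`; it is disjoint from the first, hence the
  -- factor 2.
  have h4 := hf.abs_phase_add_sub_le hD y (n - k)
  have h5 := sum_range_zmod x fun t => if t ∈ oddGapEnds (turnSet f) then (1 : ℤ) else 0
  rw [← Finset.sum_range_add_sum_Ico _ hk, Finset.sum_Ico_eq_sum_range] at h5
  have h6 : ∀ j : ℕ, x + ((k + j : ℕ) : ZMod n) = y + j := fun j => by rw [← hky]; push_cast; ring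
  simp only [h6] at h5
  rw [hky] at h3
  rw [hx'] at h4
  simp only [Finset.sum_ite_mem, Finset.univ_inter, Finset.sum_const, nsmul_eq_mul, mul_one] at h5
  have h7 := le_abs_self (phase f y - phase f x)
  have h8 := neg_abs_le (phase f x - phase f y)
  zify
  linarith

/-- The set of turns and the first step determine the function. -/
theorem IsCycleHom.eq_of_turnSet_eq {g : ZMod n → ℤ} (hf : IsCycleHom d f) (hg : IsCycleHom d g)
    (h : turnSet f = turnSet g) (h0 : f 0 = g 0) (h1 : f 1 = g 1) : f = g := by
  have key : ∀ k : ℕ, f k = g k ∧ f (k + 1) = g (k + 1) := by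
    intro k
    induction k with
    | zero => simpa using ⟨h0, h1⟩
    | succ k ih =>
      push_cast
      refine ⟨ih.2, ?_⟩
      have hm : (k + 1 + 1 : ZMod n) ∈ turnSet f ↔ (k + 1 + 1 : ZMod n) ∈ turnSet g := by rw [h]
      have e1 : (k + 1 + 1 - 2 : ZMod n) = k := by ring
      rw [mem_turnSet, mem_turnSet, e1] at hm
      have a1 := hf.step (k + 1 + 1)
      have a2 := hg.step (k + 1 + 1)
      have a3 := hf.step (k + 1)
      simp only [add_sub_cancel_right] at a1 a2 a3
      omega
  ext t
  simpa using (key t.val).1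

theorem range_subset_of_turnSet_eq_empty (h : turnSet f = ∅) : Set.range f ⊆ {f 0, f 1} := by
  have key : ∀ k : ℕ, f k ∈ ({f 0, f 1} : Set ℤ) ∧ f (k + 1) ∈ ({f 0, f 1} : Set ℤ) := by
    intro k
    induction k with
    | zero => simp
    | succ k ih =>
      have hm : (k + 1 + 1 : ZMod n) ∉ turnSet f := by simp [h]
      have e1 : (k + 1 + 1 - 2 : ZMod n) = k := by ring
      rw [mem_turnSet, not_not, e1] at hm
      push_cast
      exact ⟨ih.2, hm ▸ ih.1⟩
  rintro _ ⟨t, rfl⟩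
  simpa using (key t.val).1

theorem turnSet_nonempty_of_three_le (h : 3 ≤ (Set.range f).ncard) : (turnSet f).Nonempty := by
  rw [Finset.nonempty_iff_ne_empty]
  intro h0
  have h1 := Set.ncard_le_ncard (range_subset_of_turnSet_eq_empty h0) (by simp)
  have h2 := Set.ncard_insert_le (f 0) {f 1}
  rw [Set.ncard_singleton] at h2
  omega

end Phase

/-! ### Estimates for binomial coefficients. -/

section Choose

theorem choose_two_mul_le (n k : ℕ) : n.choose (2 * k) ≤ n.choose k ^ 2 := by
  have h := Nat.choose_mul (n := n) (k := 2 * k) (s := k) (by omega)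
  calc n.choose (2 * k) ≤ n.choose (2 * k) * (2 * k).choose k :=
        Nat.le_mul_of_pos_right _ (Nat.choose_pos (by omega))
    _ = n.choose k * (n - k).choose (2 * k - k) := h
    _ ≤ n.choose k * n.choose k := by
        rw [show 2 * k - k = k by omega]
        gcongr
        omega
    _ = n.choose k ^ 2 := by ring

/-- Each factor `(n - i) / (i + 1)` of the binomial coefficient with `i < r` is at least `(n - r) /
(r + 1)`. -/
theorem sub_pow_le_choose_mul (n r j : ℕ) (hj : j ≤ r) :
    (n - r) ^ j ≤ n.choose j * (r + 1) ^ j := by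
  induction j with
  | zero => simp
  | succ j ih =>
    calc (n - r) ^ (j + 1) = (n - r) ^ j * (n - r) := pow_succ _ _
      _ ≤ n.choose j * (r + 1) ^ j * (n - j) := by
          gcongr
          · exact ih (by omega)
          · omega
      _ = n.choose (j + 1) * (j + 1) * (r + 1) ^ j := by
          rw [Nat.choose_succ_right_eq]
          ring
      _ ≤ n.choose (j + 1) * (r + 1) * (r + 1) ^ j := by
          gcongr
          omega
      _ = n.choose (j + 1) * (r + 1) ^ (j + 1) := by ring

/-- The ratios of consecutive coefficients decrease. If `C(n,r)² ≤ M ^ r`, the squared ratio is at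
most `M` at `r`, hence from there on. -/
theorem choose_add_sq_le {n r M : ℕ} (hr : 0 < r) (hM : n.choose r ^ 2 ≤ M ^ r) (i : ℕ) :
    n.choose (r + i) ^ 2 ≤ M ^ i * n.choose r ^ 2 := by
  have h1 : (n - r) ^ 2 ≤ M * (r + 1) ^ 2 := by
    rw [← pow_le_pow_iff_left₀ (Nat.zero_le _) (Nat.zero_le _) hr.ne']
    calc ((n - r) ^ 2) ^ r = ((n - r) ^ r) ^ 2 := by ring
      _ ≤ (n.choose r * (r + 1) ^ r) ^ 2 := by
          gcongr
          exact sub_pow_le_choose_mul n r r le_rfl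
      _ = n.choose r ^ 2 * ((r + 1) ^ r) ^ 2 := by ring
      _ ≤ M ^ r * ((r + 1) ^ r) ^ 2 := by gcongr
      _ = (M * (r + 1) ^ 2) ^ r := by rw [mul_pow, pow_right_comm]
  induction i with
  | zero => simp
  | succ i ih =>
    refine Nat.le_of_mul_le_mul_right ?_ (show 0 < (r + i + 1) ^ 2 by positivity)
    calc n.choose (r + (i + 1)) ^ 2 * (r + i + 1) ^ 2
        = (n.choose (r + i + 1) * (r + i + 1)) ^ 2 := by rw [← add_assoc]; ring
      _ = n.choose (r + i) ^ 2 * (n - (r + i)) ^ 2 := by rw [Nat.choose_succ_right_eq]; ring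
      _ ≤ (M ^ i * n.choose r ^ 2) * (M * (r + i + 1) ^ 2) := by
          gcongr
          calc (n - (r + i)) ^ 2 ≤ (n - r) ^ 2 := by gcongr; omega
            _ ≤ M * (r + 1) ^ 2 := h1
            _ ≤ M * (r + i + 1) ^ 2 := by gcongr; omega
      _ = M ^ (i + 1) * n.choose r ^ 2 * (r + i + 1) ^ 2 := by ring

/-- Here `e = d - 1` and `M = 2 ^ (2d - 1)`. Growth by `M` against decay by `2 ^ (2d + 1)` leaves a
geometric series of ratio `1/4`. -/
theorem sum_choose_mul_le {n r e : ℕ} (hr : 0 < r)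
    (h : n.choose r ^ 2 ≤ (2 ^ (2 * e + 1)) ^ r) (N : ℕ) :
    ∑ i ∈ Finset.range N, (n.choose (2 * (r + i)) : ℝ) * (2 * (1 / 2) ^ ((2 * e + 3) * (r + i))) ≤
      (n.choose r : ℝ) ^ 2 * (1 / 2) ^ ((2 * e + 1) * r) := by
  have hgeom : ∑ i ∈ Finset.range N, (1 / 4 : ℝ) ^ i ≤ 2 := by
    rw [geom_sum_eq (by norm_num)]
    have : (0 : ℝ) < (1 / 4) ^ N := by positivity
    rw [div_le_iff_of_neg (by norm_num)]
    linarith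
  have hterm : ∀ i : ℕ, (n.choose (2 * (r + i)) : ℝ) * (2 * (1 / 2) ^ ((2 * e + 3) * (r + i))) ≤
      (n.choose r : ℝ) ^ 2 * (1 / 2) ^ ((2 * e + 1) * r) * (1 / 2) * (1 / 4) ^ i := by
    intro i
    have h1 : (n.choose (2 * (r + i)) : ℝ) ≤ (2 ^ (2 * e + 1)) ^ i * (n.choose r : ℝ) ^ 2 := by
      exact_mod_cast (choose_two_mul_le n (r + i)).trans (choose_add_sq_le hr h i)
    have h2 : (2 * (1 / 2) ^ ((2 * e + 3) * (r + i)) : ℝ) =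
        (1 / 2) ^ ((2 * e + 1) * r) * (1 / 2) ^ ((2 * e + 1) * i) * (2 * (1 / 4) ^ r) *
          (1 / 4) ^ i := by
      rw [show (1 / 4 : ℝ) = (1 / 2) ^ 2 by norm_num, ← pow_mul, ← pow_mul]
      ring
    have h3 : (2 * (1 / 4) ^ r : ℝ) ≤ 1 / 2 := by
      have : (1 / 4 : ℝ) ^ r ≤ (1 / 4) ^ 1 :=
        pow_le_pow_of_le_one (by norm_num) (by norm_num) hr
      linarith
    have h4 : ((2 ^ (2 * e + 1)) ^ i * (1 / 2) ^ ((2 * e + 1) * i) : ℝ) = 1 := by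
      rw [← pow_mul, ← mul_pow]
      norm_num
    calc _ ≤ (2 ^ (2 * e + 1)) ^ i * (n.choose r : ℝ) ^ 2 *
          ((1 / 2) ^ ((2 * e + 1) * r) * (1 / 2) ^ ((2 * e + 1) * i) * (1 / 2) *
          (1 / 4) ^ i) := by
            rw [h2]
            gcongr
      _ = ((2 ^ (2 * e + 1)) ^ i * (1 / 2) ^ ((2 * e + 1) * i)) *
          ((n.choose r : ℝ) ^ 2 * (1 / 2) ^ ((2 * e + 1) * r) * (1 / 2) * (1 / 4) ^ i) := by ring
      _ = _ := by rw [h4, one_mul]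
  calc _ ≤ ∑ i ∈ Finset.range N,
        (n.choose r : ℝ) ^ 2 * (1 / 2) ^ ((2 * e + 1) * r) * (1 / 2) * (1 / 4) ^ i :=
        Finset.sum_le_sum fun i _ => hterm i
    _ = (n.choose r : ℝ) ^ 2 * (1 / 2) ^ ((2 * e + 1) * r) *
        ((1 / 2) * ∑ i ∈ Finset.range N, (1 / 4 : ℝ) ^ i) := by
        rw [← Finset.mul_sum]
        ring
    _ ≤ (n.choose r : ℝ) ^ 2 * (1 / 2) ^ ((2 * e + 1) * r) * 1 := by
        gcongr
        linarith
    _ = _ := mul_one _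

end Choose

/-! ### Transfer to the graph, and counting homomorphisms. -/

section Torus

variable {n d : ℕ}

/-- A function on `{0, …, n - 1}` regarded as a function on `ℤ / n`. -/
def onZMod [NeZero n] (f : Fin n → ℤ) (t : ZMod n) : ℤ := f ⟨t.val, ZMod.val_lt t⟩

theorem onZMod_natCast [NeZero n] (f : Fin n → ℤ) (i : Fin n) : onZMod f ((i : ℕ) : ZMod n) = f i := by
  simp [onZMod, ZMod.val_natCast, Nat.mod_eq_of_lt i.2]

theorem onZMod_injective [NeZero n] : Function.Injective (onZMod (n := n)) := fun f g h => by
  ext i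
  rw [← onZMod_natCast f, h, onZMod_natCast]

theorem range_onZMod [NeZero n] (f : Fin n → ℤ) : Set.range (onZMod f) = Set.range f := by
  ext z
  constructor
  · rintro ⟨t, rfl⟩
    exact ⟨_, rfl⟩
  · rintro ⟨i, rfl⟩
    exact ⟨_, onZMod_natCast f i⟩

theorem onZMod_zero [NeZero n] {f : Fin n → ℤ} (hf : f ∈ torusHom n d) : onZMod f 0 = 0 := by
  obtain ⟨hn, h0, -⟩ := hf
  rw [← h0]
  simp [onZMod]

theorem isCycleHom_onZMod [NeZero n] (he : Even n) {f : Fin n → ℤ} (hf : f ∈ torusHom n d) :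
    IsCycleHom d (onZMod f) := by
  obtain ⟨hn, -, hadj⟩ := hf
  intro k hk y
  refine hadj _ _ ?_
  simp only [torusGraph, ZMod.val_add, ZMod.val_natCast]
  obtain ⟨m, hm⟩ := he
  have hy := ZMod.val_lt y
  have hc := Nat.mod_lt (2 * k + 1) hn
  have hle := Nat.mod_le (2 * k + 1) n
  have hodd : (2 * k + 1) % n % 2 = 1 := by
    rw [Nat.mod_mod_of_dvd _ ⟨m, by omega⟩]
    omega
  generalize (2 * k + 1) % n = c at hc hle hodd
  obtain ⟨z, hz, hzn⟩ : ∃ z, (y.val + c) % n = z ∧ z < n ∧ (z = y.val + c ∨ z + n = y.val + c) := by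
    rcases lt_or_ge (y.val + c) n with h | h
    · exact ⟨_, Nat.mod_eq_of_lt h, h, Or.inl rfl⟩
    · refine ⟨y.val + c - n, ?_, by omega, by omega⟩
      rw [Nat.mod_eq_sub_mod h, Nat.mod_eq_of_lt (by omega)]
  rw [hz]
  -- The jump reduces mod the even `n` to an odd `c ≤ 2k + 1`, whose cyclic length is `min c (n -
  -- c)`.
  refine ⟨min c (n - c) / 2, by omega, ?_⟩
  rcases abs_cases ((z : ℤ) - (y.val : ℤ)) with ⟨h, h'⟩ | ⟨h, h'⟩ <;> rw [h] <;> omega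

/-- The homomorphisms that vanish at even vertices. -/
def evenZeroHom (n : ℕ) (A : Finset (Fin (n / 2))) (i : Fin n) : ℤ :=
  if (i : ℕ) % 2 = 0 then 0 else if ∃ j ∈ A, (j : ℕ) = i / 2 then 1 else -1

theorem torusGraph_adj_parity (he : Even n) {x y : Fin n} (h : (torusGraph n d).Adj x y) :
    (x : ℕ) % 2 ≠ (y : ℕ) % 2 := by
  obtain ⟨k, -, hk⟩ := h
  obtain ⟨m, hm⟩ := he
  rcases abs_cases ((x : ℤ) - (y : ℤ)) with ⟨h, h'⟩ | ⟨h, h'⟩ <;> rw [h] at hk <;> omega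

theorem evenZeroHom_mem (hn : 0 < n) (he : Even n) (A : Finset (Fin (n / 2))) :
    evenZeroHom n A ∈ torusHom n d := by
  refine ⟨hn, by simp [evenZeroHom], fun x y h => ?_⟩
  have := torusGraph_adj_parity he h
  unfold evenZeroHom
  split_ifs <;> first | omega | simp

theorem evenZeroHom_injective (n : ℕ) : Function.Injective (evenZeroHom n) := by
  intro A B h
  ext j
  have h1 := congrFun h ⟨2 * j + 1, by omega⟩
  have h2 : (2 * (j : ℕ) + 1) / 2 = j := by omega
  have h3 : (2 * (j : ℕ) + 1) % 2 ≠ 0 := by omega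
  simp only [evenZeroHom, h2, h3, if_false, ← Fin.ext_iff, exists_eq_right] at h1
  split_ifs at h1 <;> simp_all

/-- Edges join opposite parities, so with 0 at the even vertices the signs at the odd ones are free.
-/
theorem two_pow_le_ncard_torusHom (hn : 0 < n) (he : Even n) (d : ℕ) :
    2 ^ (n / 2) ≤ (torusHom n d).ncard := by
  have h := Set.ncard_le_ncard_of_injOn (s := (Set.univ : Set (Finset (Fin (n / 2)))))
    (t := torusHom n d) (evenZeroHom n) (fun A _ => evenZeroHom_mem hn he A)
    (evenZeroHom_injective n).injOn (torusHom_finite n d)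
  simpa [Set.ncard_univ] using h

theorem ncard_oddGapEnds_eq_le [NeZero n] (he : Even n) (d k : ℕ) (hk : 0 < k)
    (U : Finset (ZMod n)) (hU : U.card = 2 * k) :
    {f ∈ torusHom n d | oddGapEnds (turnSet (onZMod f)) = U}.ncard * 2 ^ ((2 * d + 1) * k) ≤
      2 * 2 ^ (n / 2) := by
  rcases Set.eq_empty_or_nonempty {f ∈ torusHom n d | oddGapEnds (turnSet (onZMod f)) = U} with
    h0 | ⟨f₀, hf₀, hf₀U⟩
  · simp [h0]
  have hUne : U.Nonempty := Finset.card_pos.1 (by omega)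
  have hD : ∀ f : Fin n → ℤ, oddGapEnds (turnSet (onZMod f)) = U → (turnSet (onZMod f)).Nonempty :=
    fun f hf => (hf ▸ hUne).mono oddGapEnds_subset
  have hgap : ∀ f ∈ torusHom n d, ∀ t ∈ oddGapEnds (turnSet (onZMod f)),
      2 * d ≤ age (turnSet (onZMod f)) (t - 1) :=
    fun f hf => (isCycleHom_onZMod he hf).two_mul_le_age
  have hfree : ∀ f : Fin n → ℤ, oddGapEnds (turnSet (onZMod f)) = U →
      freePoints (turnSet (onZMod f)) d = freePoints (turnSet (onZMod f₀)) d := by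
    intro f hf
    have h := evenAge_eq_of_oddGapEnds_eq (hf ▸ hUne) (hf.trans hf₀U.symm)
    rw [freePoints, freePoints, h, hf, hf₀U]
  have hcard := two_mul_card_freePoints (hD f₀ hf₀U) (hgap f₀ hf₀)
  rw [hf₀U, hU] at hcard
  have h := Set.ncard_le_ncard_of_injOn
    (s := {f ∈ torusHom n d | oddGapEnds (turnSet (onZMod f)) = U})
    (t := ((Finset.univ : Finset Bool) ×ˢ (freePoints (turnSet (onZMod f₀)) d).powerset :
      Finset (Bool × Finset (ZMod n))))
    -- The Boolean records the first step `f 1 = ±1`, the set records the turns outside `U`.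
    (fun f => (decide (onZMod f 1 = 1), turnSet (onZMod f) \ U)) ?_ ?_ (Finset.finite_toSet _)
  · rw [Set.ncard_coe_finset, Finset.card_product, Finset.card_powerset, Finset.card_univ,
      Fintype.card_bool] at h
    calc _ ≤ 2 * 2 ^ (freePoints (turnSet (onZMod f₀)) d).card * 2 ^ ((2 * d + 1) * k) := by
          gcongr
      _ = 2 * 2 ^ (n / 2) := by
          rw [mul_assoc, ← pow_add]
          congr 2
          have : (2 * d + 1) * (2 * k) = 2 * ((2 * d + 1) * k) := by ring
          omega
  · rintro f ⟨hf, hfU⟩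
    simp only [Finset.coe_product, Finset.coe_univ, Finset.coe_powerset, Set.mem_prod,
      Set.mem_univ, true_and, Set.mem_preimage, Set.mem_powerset_iff, Finset.coe_subset]
    rw [← hfree f hfU]
    have := sdiff_subset_freePoints (hD f hfU) (hgap f hf)
    rwa [hfU] at this
  · rintro f ⟨hf, hfU⟩ g ⟨hg, hgU⟩ heq
    simp only [Prod.mk.injEq, decide_eq_decide] at heq
    have hf' := isCycleHom_onZMod he hf
    have hg' := isCycleHom_onZMod he hg
    have hf0 := onZMod_zero hf
    have hg0 := onZMod_zero hg
    refine onZMod_injective (hf'.eq_of_turnSet_eq hg' ?_ (hf0.trans hg0.symm) ?_)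
    · rw [← Finset.sdiff_union_of_subset (oddGapEnds_subset (D := turnSet (onZMod f))),
        ← Finset.sdiff_union_of_subset (oddGapEnds_subset (D := turnSet (onZMod g))), hfU, hgU,
        heq.2]
    · have a1 := hf'.step 1
      have a2 := hg'.step 1
      rw [sub_self] at a1 a2
      omega

theorem ncard_range_ge_le (hn : 0 < n) (he : Even n) (d r : ℕ) (hr : 0 < r) :
    ((torusHom n d ∩ {f | 3 + r ≤ (Set.range f).ncard}).ncard : ℝ) ≤
      2 ^ (n / 2) * ∑ i ∈ Finset.range (n + 1),
        (n.choose (2 * (r + i)) : ℝ) * (2 * (1 / 2) ^ ((2 * d + 1) * (r + i))) := by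
  have : NeZero n := ⟨hn.ne'⟩
  classical
  set T := (torusHom_finite n d).toFinset with hT
  set F : Finset (ZMod n) → Finset (Fin n → ℤ) :=
    fun U => T.filter fun f => oddGapEnds (turnSet (onZMod f)) = U with hF
  have hF' : ∀ i, ∀ U ∈ Finset.powersetCard (2 * (r + i)) (Finset.univ : Finset (ZMod n)),
      ((F U).card : ℝ) ≤ 2 ^ (n / 2) * (2 * (1 / 2) ^ ((2 * d + 1) * (r + i))) := by
    intro i U hU
    have h1 := ncard_oddGapEnds_eq_le he d (r + i) (by omega) U (Finset.mem_powersetCard.1 hU).2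
    have h2 : {f ∈ torusHom n d | oddGapEnds (turnSet (onZMod f)) = U} = (F U : Set (Fin n → ℤ)) := by
      ext f
      simp [hF, hT]
    rw [h2, Set.ncard_coe_finset] at h1
    have h3 : ((F U).card : ℝ) * 2 ^ ((2 * d + 1) * (r + i)) ≤ 2 * 2 ^ (n / 2) := by
      exact_mod_cast h1
    rw [← le_div_iff₀ (by positivity)] at h3
    refine h3.trans (le_of_eq ?_)
    rw [one_div, inv_pow]
    ring
  have hsub : torusHom n d ∩ {f | 3 + r ≤ (Set.range f).ncard} ⊆
      ((Finset.range (n + 1)).biUnion fun i =>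
        (Finset.powersetCard (2 * (r + i)) (Finset.univ : Finset (ZMod n))).biUnion F :
          Finset (Fin n → ℤ)) := by
    rintro f ⟨hf, hfr⟩
    simp only [Set.mem_ofPred_eq] at hfr
    rw [← range_onZMod] at hfr
    have hf' := isCycleHom_onZMod he hf
    have hD := turnSet_nonempty_of_three_le (f := onZMod f) (by omega)
    have h1 := hf'.two_mul_le_card_oddGapEnds hD hfr
    have h2 := two_mul_card_evenAge hD
    have h3 : (oddGapEnds (turnSet (onZMod f))).card ≤ n := by
      simpa [ZMod.card] using Finset.card_le_univ (oddGapEnds (turnSet (onZMod f)))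
    obtain ⟨m, hm⟩ := he
    simp only [Finset.coe_biUnion, Set.mem_iUnion, Finset.mem_coe, Finset.mem_range,
      Finset.mem_powersetCard, hF, hT, Finset.mem_filter, Set.Finite.mem_toFinset]
    exact ⟨(oddGapEnds (turnSet (onZMod f))).card / 2 - r, by omega, _,
      ⟨Finset.subset_univ _, by omega⟩, hf, rfl⟩
  calc ((torusHom n d ∩ {f | 3 + r ≤ (Set.range f).ncard}).ncard : ℝ)
      ≤ (((Finset.range (n + 1)).biUnion fun i =>
        (Finset.powersetCard (2 * (r + i)) (Finset.univ : Finset (ZMod n))).biUnion F).card : ℝ) := by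
        have := Set.ncard_le_ncard hsub (Finset.finite_toSet _)
        rw [Set.ncard_coe_finset] at this
        exact_mod_cast this
    _ ≤ ∑ i ∈ Finset.range (n + 1),
        ∑ U ∈ Finset.powersetCard (2 * (r + i)) (Finset.univ : Finset (ZMod n)),
          ((F U).card : ℝ) := by
        exact_mod_cast Finset.card_biUnion_le.trans
          (Finset.sum_le_sum fun i _ => Finset.card_biUnion_le)
    _ ≤ ∑ i ∈ Finset.range (n + 1),
        (n.choose (2 * (r + i)) : ℝ) * (2 ^ (n / 2) * (2 * (1 / 2) ^ ((2 * d + 1) * (r + i)))) := by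
        refine Finset.sum_le_sum fun i _ => ?_
        refine (Finset.sum_le_card_nsmul _ _ _ (hF' i)).trans (le_of_eq ?_)
        rw [Finset.card_powersetCard, Finset.card_univ, ZMod.card, nsmul_eq_mul]
    _ = _ := by
        rw [Finset.mul_sum]
        refine Finset.sum_congr rfl fun i _ => ?_
        ring

/-- With only the values 0 and `f 1`, `f` must alternate, so `f 1 = ±1` determines it. -/
theorem ncard_range_lt_three_le (hn : 0 < n) (he : Even n) (d : ℕ) :
    (torusHom n d ∩ {f | (Set.range f).ncard < 3}).ncard ≤ 2 := by
  have : NeZero n := ⟨hn.ne'⟩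
  have key : ∀ f ∈ torusHom n d, (Set.range f).ncard < 3 → ∀ k : ℕ,
      onZMod f k = if Even k then 0 else onZMod f 1 := by
    intro f hf hlt k
    have h0 := onZMod_zero hf
    have hf' := isCycleHom_onZMod he hf
    have h1 := hf'.step 1
    rw [sub_self, h0] at h1
    have hsub : ({0, onZMod f 1} : Set ℤ) ⊆ Set.range (onZMod f) := by
      rintro _ (rfl | rfl)
      exacts [⟨0, h0⟩, ⟨1, rfl⟩]
    have heq : ({0, onZMod f 1} : Set ℤ) = Set.range (onZMod f) := by
      refine Set.eq_of_subset_of_ncard_le hsub ?_ (Set.finite_range _)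
      rw [range_onZMod, Set.ncard_pair (by omega)]
      omega
    have hval : ∀ t, onZMod f t = 0 ∨ onZMod f t = onZMod f 1 := fun t => by
      have : onZMod f t ∈ Set.range (onZMod f) := ⟨t, rfl⟩
      rw [← heq] at this
      simpa using this
    induction k with
    | zero => simpa using h0
    | succ k ih =>
      have h2 := hf'.step (k + 1)
      have h3 := hval (k + 1)
      rw [add_sub_cancel_right, ih] at h2
      push_cast
      by_cases hk : Even k
      · simp only [hk, if_true, Nat.even_add_one, not_true_eq_false, if_false] at h2 ⊢
        omega
      · simp only [hk, if_false, Nat.even_add_one, not_false_eq_true, if_true] at h2 ⊢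
        omega
  have h := Set.ncard_le_ncard_of_injOn (s := torusHom n d ∩ {f | (Set.range f).ncard < 3})
    (t := ({1, -1} : Set ℤ)) (fun f => onZMod f 1) ?_ ?_
  · rwa [Set.ncard_pair (by norm_num)] at h
  · rintro f ⟨hf, -⟩
    have h1 := (isCycleHom_onZMod he hf).step 1
    rw [sub_self, onZMod_zero hf] at h1
    simpa using h1
  · rintro f ⟨hf, hf3⟩ g ⟨hg, hg3⟩ heq
    refine onZMod_injective (funext fun t => ?_)
    have h1 := key f hf hf3 t.val
    have h2 := key g hg hg3 t.val
    rw [ZMod.natCast_zmod_val] at h1 h2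
    simp only at heq
    rw [h1, h2, heq]

/-! ### Probability bounds and the limit. -/

theorem torusLaw_real_apply (n d : ℕ) (A : Set (Fin n → ℤ)) :
    (torusLaw n d).real A = (torusHom n d ∩ A).ncard / (torusHom n d).ncard := by
  have hfin := torusHom_finite n d
  rw [MeasureTheory.measureReal_def, torusLaw, ProbabilityTheory.uniformOn,
    ProbabilityTheory.cond_apply hfin.measurableSet,
    MeasureTheory.Measure.count_apply_finite _ hfin,
    MeasureTheory.Measure.count_apply_finite _ (hfin.inter_of_left A),
    ← Set.ncard_eq_toFinset_card _ hfin, ← Set.ncard_eq_toFinset_card _ (hfin.inter_of_left A)]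
  simp [div_eq_inv_mul]

theorem torusLaw_real_range_ge_le {r : ℕ} (hn : 0 < n) (he : Even n) (hd : 0 < d) (hr : 0 < r) :
    (torusLaw n d).real {f | 3 + r ≤ (Set.range f).ncard} ≤
      (n.choose r : ℝ) ^ 2 * (2 : ℝ) ^ (-((2 * (d : ℝ) - 1) * (r : ℝ))) := by
  have := torusLaw_isProbabilityMeasure hn he d
  obtain ⟨e, rfl⟩ := Nat.exists_eq_add_of_lt hd
  rw [zero_add] at *
  have hexp : (2 : ℝ) ^ (-((2 * ((e + 1 : ℕ) : ℝ) - 1) * (r : ℝ))) = (1 / 2) ^ ((2 * e + 1) * r) := by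
    rw [Real.rpow_neg two_pos.le, one_div, inv_pow, ← Real.rpow_natCast]
    congr 2
    push_cast
    ring
  rw [hexp]
  -- If this fails, the claimed bound is at least 1 and there is nothing to prove.
  by_cases h : n.choose r ^ 2 ≤ (2 ^ (2 * e + 1)) ^ r
  · have h1 := ncard_range_ge_le hn he (e + 1) r hr
    have h2 := sum_choose_mul_le (N := n + 1) hr h
    have h3 : (2 ^ (n / 2) : ℝ) ≤ (torusHom n (e + 1)).ncard := by
      exact_mod_cast two_pow_le_ncard_torusHom hn he (e + 1)
    rw [show 2 * (e + 1) + 1 = 2 * e + 3 by ring] at h1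
    rw [torusLaw_real_apply, div_le_iff₀ (lt_of_lt_of_le (by positivity) h3)]
    calc _ ≤ _ := h1
      _ ≤ 2 ^ (n / 2) * ((n.choose r : ℝ) ^ 2 * (1 / 2) ^ ((2 * e + 1) * r)) := by gcongr
      _ ≤ _ := by
        rw [mul_comm]
        gcongr
  · refine MeasureTheory.measureReal_le_one.trans ?_
    have h1 : ((2 ^ (2 * e + 1)) ^ r : ℝ) ≤ (n.choose r : ℝ) ^ 2 := by
      exact_mod_cast (not_le.1 h).le
    rw [← pow_mul] at h1
    rw [one_div, inv_pow, ← div_eq_mul_inv, one_le_div (by positivity)]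
    exact h1

theorem torusLaw_real_range_lt_three_le (hn : 0 < n) (he : Even n) (d : ℕ) :
    (torusLaw n d).real {f | (Set.range f).ncard < 3} ≤ (2 : ℝ) ^ (1 - (n : ℝ) / 2) := by
  have h1 : ((torusHom n d ∩ {f | (Set.range f).ncard < 3}).ncard : ℝ) ≤ 2 := by
    exact_mod_cast ncard_range_lt_three_le hn he d
  have h2 : (2 ^ (n / 2) : ℝ) ≤ (torusHom n d).ncard := by
    exact_mod_cast two_pow_le_ncard_torusHom hn he d
  have h3 : (2 : ℝ) ^ (1 - (n : ℝ) / 2) = 2 / 2 ^ (n / 2) := by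
    rw [Real.rpow_sub two_pos, Real.rpow_one, ← Real.rpow_natCast,
      Nat.cast_div he.two_dvd (by norm_num)]
    norm_num
  rw [torusLaw_real_apply, h3]
  gcongr

theorem tendsto_torusLaw_real_range_eq_three {d : ℕ → ℕ}
    (hd : Tendsto (fun n : ℕ => (d n : ℝ) - Real.logb 2 (n : ℝ))
      (atTop ⊓ 𝓟 {n : ℕ | Even n}) atTop) :
    Tendsto (fun n : ℕ => (torusLaw n (d n)).real {f | (Set.range f).ncard = 3})
      (atTop ⊓ 𝓟 {n : ℕ | Even n}) (𝓝 1) := by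
  have hpos : ∀ᶠ n : ℕ in atTop ⊓ 𝓟 {n : ℕ | Even n}, 0 < n :=
    (eventually_gt_atTop 0).filter_mono inf_le_left
  have heven : ∀ᶠ n : ℕ in atTop ⊓ 𝓟 {n : ℕ | Even n}, Even n :=
    (eventually_principal.2 fun _ h => h).filter_mono inf_le_right
  have hlim : ∀ u : ℕ → ℝ, Tendsto u (atTop ⊓ 𝓟 {n : ℕ | Even n}) atBot →
      Tendsto (fun n => (2 : ℝ) ^ u n) (atTop ⊓ 𝓟 {n : ℕ | Even n}) (𝓝 0) := fun u hu =>
    (tendsto_rpow_atBot_of_base_gt_one 2 one_lt_two).comp hu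
  have h1 : Tendsto (fun n : ℕ => (2 : ℝ) ^ (1 - 2 * ((d n : ℝ) - Real.logb 2 (n : ℝ))))
      (atTop ⊓ 𝓟 {n : ℕ | Even n}) (𝓝 0) :=
    hlim _ (tendsto_atBot_add_const_left _ 1
      (tendsto_neg_atTop_atBot.comp (hd.const_mul_atTop two_pos)))
  have h2 : Tendsto (fun n : ℕ => (2 : ℝ) ^ (1 - (n : ℝ) / 2))
      (atTop ⊓ 𝓟 {n : ℕ | Even n}) (𝓝 0) :=
    hlim _ (tendsto_atBot_add_const_left _ 1 (tendsto_neg_atTop_atBot.comp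
      ((tendsto_natCast_atTop_atTop.atTop_div_const two_pos).mono_left inf_le_left)))
  have h3 := (tendsto_const_nhds (x := (1 : ℝ))).sub (h1.add h2)
  rw [add_zero, sub_zero] at h3
  refine tendsto_of_tendsto_of_tendsto_of_le_of_le' h3 tendsto_const_nhds ?_ ?_
  · filter_upwards [hpos, heven, hd.eventually_gt_atTop 0] with n hn he hdn
    have := torusLaw_isProbabilityMeasure hn he (d n)
    have hlog : 0 ≤ Real.logb 2 (n : ℝ) := Real.logb_nonneg one_lt_two (by exact_mod_cast hn)
    have hd0 : 0 < d n := by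
      have : (0 : ℝ) < d n := by linarith
      exact_mod_cast this
    have a1 := torusLaw_real_range_ge_le (r := 1) hn he hd0 one_pos
    have a2 := torusLaw_real_range_lt_three_le hn he (d n)
    -- For `r = 1`, writing `n` as a power of 2 exposes `d n - log₂ n` in the exponent.
    have a3 : ((n.choose 1 : ℕ) : ℝ) ^ 2 * (2 : ℝ) ^ (-((2 * (d n : ℝ) - 1) * ((1 : ℕ) : ℝ))) =
        (2 : ℝ) ^ (1 - 2 * ((d n : ℝ) - Real.logb 2 (n : ℝ))) := by
      have : (n : ℝ) = (2 : ℝ) ^ Real.logb 2 (n : ℝ) :=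
        (Real.rpow_logb two_pos (by norm_num) (by exact_mod_cast hn)).symm
      rw [Nat.choose_one_right]
      nth_rewrite 1 [this]
      rw [← Real.rpow_natCast, ← Real.rpow_mul two_pos.le, ← Real.rpow_add two_pos]
      congr 1
      push_cast
      ring
    rw [a3] at a1
    have a4 : (torusLaw n (d n)).real Set.univ ≤
        (torusLaw n (d n)).real {f | (Set.range f).ncard = 3} +
        ((torusLaw n (d n)).real {f | 3 + 1 ≤ (Set.range f).ncard} +
        (torusLaw n (d n)).real {f | (Set.range f).ncard < 3}) := by
      have hcover : (Set.univ : Set (Fin n → ℤ)) ⊆ {f | (Set.range f).ncard = 3} ∪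
          ({f | 3 + 1 ≤ (Set.range f).ncard} ∪ {f | (Set.range f).ncard < 3}) := by
        intro f _
        simp only [Set.mem_union, Set.mem_ofPred_eq]
        omega
      refine (MeasureTheory.measureReal_mono hcover).trans
        ((MeasureTheory.measureReal_union_le _ _).trans ?_)
      gcongr
      exact MeasureTheory.measureReal_union_le _ _
    rw [MeasureTheory.probReal_univ] at a4
    linarith
  · filter_upwards [hpos, heven] with n hn he
    have := torusLaw_isProbabilityMeasure hn he (d n)
    exact MeasureTheory.measureReal_le_one

end Torus

theorem theorem2p6 :
    (∀ n d r : ℕ, 0 < n → Even n → 0 < d → 0 < r →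
      (torusLaw n d).real {f | 3 + r ≤ (Set.range f).ncard}
        ≤ (n.choose r : ℝ) ^ 2 * (2 : ℝ) ^ (-((2 * (d : ℝ) - 1) * (r : ℝ))) ∧
      (torusLaw n d).real {f | (Set.range f).ncard < 3} ≤ (2 : ℝ) ^ (1 - (n : ℝ) / 2)) ∧
    (∀ d : ℕ → ℕ,
      Tendsto (fun n : ℕ => (d n : ℝ) - Real.logb 2 (n : ℝ))
        (atTop ⊓ 𝓟 {n : ℕ | Even n}) atTop →
      Tendsto (fun n : ℕ => (torusLaw n (d n)).real {f | (Set.range f).ncard = 3})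
        (atTop ⊓ 𝓟 {n : ℕ | Even n}) (𝓝 1)) :=
  ⟨fun _ _ _ hn he hd hr => ⟨torusLaw_real_range_ge_le hn he hd hr,
    torusLaw_real_range_lt_three_le hn he _⟩, fun _ hd => tendsto_torusLaw_real_range_eq_three hd⟩
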